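/- Let $\alpha,c>0$, $\lambda_0>0$, let $h:[0,\infty)\to[0,\infty)$ be integrable with $\varrho:=\|h\|_{L^1}=\int_0^\infty h(t)\,\mathrm dt$, and suppose that $\frac{\alpha}{c}\varrho<1$. Consider a marked univariate linear Hawkes process or delayed Hawkes process in its cluster representation: immigrants arrive on $[0,\infty)$ according to a homogeneous Poisson process of rate $\lambda_0$; every event (immigrant or descendant), independently of everything else, draws a mark $B\sim\Gamma(\alpha,c)$, i.e. with density $f_B(x)=\frac{c^\alpha x^{\alpha-1}e^{-cx}}{\Gamma(\alpha)}$, $x>0$, and an independent service requirement $J\ge 0$ from an arbitrary fixed distribution; given $(B,J)$, an event occurring at time $s$ produces children according to an inhomogeneous Poisson process whose intensity at time $s+t$, $t\ge0$, is $B\,h(t)$ in the Hawkes case and $B\,h(t-J)\mathbf 1\{t>J\}$ in the delayed Hawkes case, these processes being conditionally independent for distinct events and independent of the immigration. Let $Z$ be the total cluster size of an immigrant, i.e. the total number of its descendants over all generations, including the immigrant itself. Then $Z$ is finite almost surely, and $$\mathbb P(Z=n)=\frac1n\binom{(\alpha+1)n-2}{n-1}\left(\frac{c}{c+\varrho}\right)^{\alpha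 n}\left(\frac{\varrho}{c+\varrho}\right)^{n-1},\qquad n\in\{1,2,3,\dots\},$$ where $\binom xy=\frac{\Gamma(x+1)}{\Gamma(y+1)\Gamma(x-y+1)}$ for real $x,y$ with $x>y-1$ (and $0^0=1$). -/

import Mathlib

open MeasureTheory ProbabilityTheory Set
open scoped ENNReal NNReal

noncomputable section

/-- The probability law `Q` on the space of measures on `ℝ` is the law of a Poisson point process
with intensity measure `μ`: the number of points in a measurable set `A` with `μ A < ∞` is Poisson
distributed with mean `μ A`, and the numbers of points in finitely many pairwise disjoint measurable
sets are independent. -/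
structure IsPoissonProcessLaw (Q : Measure (Measure ℝ)) (μ : Measure ℝ) : Prop where
  isProbabilityMeasure : IsProbabilityMeasure Q
  count_law : ∀ A : Set ℝ, MeasurableSet A → μ A ≠ ∞ →
    Q.map (fun N => N A) = (poissonMeasure (μ A).toNNReal).map (fun n : ℕ => (n : ℝ≥0∞))
  indep : ∀ (m : ℕ) (A : Fin m → Set ℝ), (∀ i, MeasurableSet (A i)) →
    Pairwise (fun i j => Disjoint (A i) (A j)) →
      iIndepFun (fun (i : Fin m) (N : Measure ℝ) => N (A i)) Q

/-- The measure on `[0, ∞)` with density `f`. -/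
def intensityMeasure (f : ℝ → ℝ) : Measure ℝ :=
  (volume.restrict (Ici 0)).withDensity (fun t => ENNReal.ofReal (f t))

/-- The position of the point with index `k` (that is, of the `(k+1)`-st point from the left) of the
point configuration given by the counting measure `N`. -/
def arrivalTime (N : Measure ℝ) (k : ℕ) : ℝ :=
  sInf {t : ℝ | (k : ℝ≥0∞) + 1 ≤ N (Iic t)}

/-- The random ingredients of the cluster construction. Immigrants are numbered by `r : ℕ` in order
of arrival. A potential event in the cluster of immigrant `r` is addressed by a label
`u : List ℕ`: the label `[]` is the immigrant itself, and `k :: u` is the child with index `k`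
of the event with label `u`. -/
structure ClusterData (Ω : Type*) where
  /-- the point process of immigration times -/
  immigration : Ω → Measure ℝ
  /-- the mark of an event -/
  mark : ℕ → List ℕ → Ω → ℝ
  /-- the service requirement (sojourn time) of an event -/
  service : ℕ → List ℕ → Ω → ℝ
  /-- the point process of the ages of an event at which its children are born -/
  offspring : ℕ → List ℕ → Ω → Measure ℝ

namespace ClusterData

variable {Ω : Type*} (X : ClusterData Ω)

/-- The potential event with label `u` occurs: its parent occurs, and its parent has enough
children. -/
def Occurs (r : ℕ) (ω : Ω) : List ℕ → Prop
  | [] => True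
  | k :: u => Occurs r ω u ∧ (k : ℝ≥0∞) < X.offspring r u ω univ

/-- The time of the event with label `u`. -/
def eventTime (r : ℕ) (ω : Ω) : List ℕ → ℝ
  | [] => arrivalTime (X.immigration ω) r
  | k :: u => eventTime r ω u + arrivalTime (X.offspring r u ω) k

/-- The cluster of immigrant `r`, as a point process: all events whose oldest ancestor is
immigrant `r`, including the immigrant itself. -/
def cluster (r : ℕ) (ω : Ω) : Measure ℝ :=
  Measure.sum (fun u : {u : List ℕ // X.Occurs r ω u} => Measure.dirac (X.eventTime r ω u))

/-- The point process of all events, the superposition of all the clusters. -/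
def pointProcess (ω : Ω) : Measure ℝ :=
  Measure.sum (fun r : ℕ => X.cluster r ω)

/-- The total cluster size of immigrant `r`: the total number of its descendants, including the
immigrant itself. -/
def clusterSize (r : ℕ) (ω : Ω) : ℝ≥0∞ :=
  X.cluster r ω univ

/-- `X` is (the cluster representation of) a univariate linear Hawkes process on `[0, ∞)` with
sojourn-time dependent excitation: immigrants arrive according to a homogeneous Poisson process of
rate `lam0`; each event independently draws a mark `b` from `markLaw` and a service
requirement `w` from `serviceLaw`, independently of each other; given `(b, w)`, it produces
children, relative to its own time, according to a Poisson process of intensity `φ b w`; and all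
this is independent for distinct events and independent of the immigration. -/
structure IsHawkes [MeasurableSpace Ω] (P : Measure Ω) (lam0 : ℝ)
    (markLaw serviceLaw : Measure ℝ) (φ : ℝ → ℝ → ℝ → ℝ) : Prop where
  measurable_immigration : Measurable X.immigration
  measurable_mark : ∀ r u, Measurable (X.mark r u)
  measurable_service : ∀ r u, Measurable (X.service r u)
  measurable_offspring : ∀ r u, Measurable (X.offspring r u)
  immigration_law :
    IsPoissonProcessLaw (P.map X.immigration) (intensityMeasure (fun _ => lam0))
  event_law : ∃ κ : Kernel (ℝ × ℝ) (Measure ℝ), IsMarkovKernel κ ∧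
    (∀ᵐ p ∂(markLaw.prod serviceLaw),
      IsPoissonProcessLaw (κ p) (intensityMeasure (φ p.1 p.2))) ∧
    ∀ r u, P.map (fun ω => ((X.mark r u ω, X.service r u ω), X.offspring r u ω)) =
      (markLaw.prod serviceLaw).compProd κ
  indep_events :
    iIndepFun (fun (i : ℕ × List ℕ) (ω : Ω) =>
      ((X.mark i.1 i.2 ω, X.service i.1 i.2 ω), X.offspring i.1 i.2 ω)) P
  indep_immigration :
    IndepFun X.immigration
      (fun (ω : Ω) (i : ℕ × List ℕ) =>
        ((X.mark i.1 i.2 ω, X.service i.1 i.2 ω), X.offspring i.1 i.2 ω)) P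

end ClusterData

/-- Excitation of the classical marked Hawkes process: an event with mark `b` excites by `b * h t`
at age `t`. -/
def hawkesExcitation (h : ℝ → ℝ) (b _w t : ℝ) : ℝ :=
  b * h t

/-- Excitation of the delayed Hawkes process: an event with mark `b` and service requirement `w`
excites by `b * h (t - w)` at age `t`, if `t > w`, and not at all before. -/
def delayedHawkesExcitation (h : ℝ → ℝ) (b w t : ℝ) : ℝ :=
  if w < t then b * h (t - w) else 0

/-- The `L¹` norm on `[0, ∞)`. -/
def l1Norm (h : ℝ → ℝ) : ℝ :=
  ∫ t in Ici (0 : ℝ), |h t|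

/-- The generalised binomial coefficient of real `x` and `y` with `x > y - 1`. -/
def genBinom (x y : ℝ) : ℝ :=
  Real.Gamma (x + 1) / (Real.Gamma (y + 1) * Real.Gamma (x - y + 1))

end

/-! Birth times do not affect the cluster size, only the numbers of children do. Shifting `h` by a
nonnegative delay keeps its mass, so under either excitation an event with mark `b` has a Poisson
number of children with mean `b * ρ`, where `ρ = l1Norm h`. Hence `Z` is the total progeny of a
Galton-Watson tree whose offspring law is a gamma mixture of Poisson laws, i.e. negative binomial
with generating function `f(x) = (c/(c+ρ))^α (1 - ρx/(c+ρ))^(-α)`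
(`offspringSeries_gammaPoissonMeasure`).

Splitting the tree at the root gives `G = X * f(G)` for the generating function `G` of the progeny
(`coeff_succ_progenySeries`). Lagrange inversion (`PowerSeries.lagrange_of_recursion`) turns this
into `P(Z = n) = (1/n) [x^(n-1)] f^n`. Since `f^n` has the same form with `α` replaced by `nα`, the
coefficient is explicit. Finiteness is subcriticality: the mean offspring number `αρ/c` is below 1,
so the expected tree size is a convergent geometric series (`ae_treeSize_lt_top`). -/

/-! ### Lagrange inversion for formal power series. -/

section PowerSeries

open PowerSeries Finset

theorem PowerSeries.coeff_pow_eq_zero_of_lt {G : ℝ⟦X⟧} (hG0 : coeff 0 G = 0) {n j : ℕ}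
    (hnj : n < j) : coeff n (G ^ j) = 0 := by
  have hX : (X : ℝ⟦X⟧) ∣ G := by
    rw [X_dvd_iff, ← coeff_zero_eq_constantCoeff_apply, hG0]
  exact X_pow_dvd_iff.1 (pow_dvd_pow_of_dvd hX j) n hnj

/-- Multiply `G = X * f(G)` by `G^k`. Terms with `j > n` drop out because `G^j` has order at least
`j`. -/
theorem PowerSeries.coeff_succ_pow_succ_of_recursion {f G : ℝ⟦X⟧} (hG0 : coeff 0 G = 0)
    (hG : ∀ n, coeff (n + 1) G = ∑ j ∈ range (n + 1), coeff j f * coeff n (G ^ j)) (n k : ℕ) :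
    coeff (n + 1) (G ^ (k + 1)) = ∑ j ∈ range (n + 1), coeff j f * coeff n (G ^ (k + j)) := by
  set H : ℝ⟦X⟧ := mk fun n => coeff (n + 1) G with hH
  have hGH : G = X * H := by
    ext m
    cases m with
    | zero => simpa using hG0
    | succ m => simp [coeff_succ_X_mul, hH]
  have hHc : ∀ a ≤ n, coeff a H = ∑ j ∈ range (n + 1), coeff j f * coeff a (G ^ j) := by
    intro a ha
    rw [hH, coeff_mk, hG]
    refine sum_subset (range_subset_range.2 (by omega)) fun j _ hj => ?_
    rw [coeff_pow_eq_zero_of_lt hG0 (by simpa using hj), mul_zero]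
  have e : G ^ (k + 1) = X * (H * G ^ k) := by
    rw [pow_succ']
    nth_rewrite 1 [hGH]
    ring
  rw [e, coeff_succ_X_mul, coeff_mul]
  have : ∀ j, coeff n (G ^ (k + j)) =
      ∑ p ∈ antidiagonal n, coeff p.1 (G ^ j) * coeff p.2 (G ^ k) := by
    intro j
    rw [← coeff_mul, ← pow_add, add_comm]
  simp_rw [this, mul_sum]
  rw [sum_comm]
  refine sum_congr rfl fun p hp => ?_
  rw [hHc p.1 (HasAntidiagonal.antidiagonal.fst_le hp), sum_mul]
  exact sum_congr rfl fun j _ => by ring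

theorem PowerSeries.coeff_X_mul_derivative (g : ℝ⟦X⟧) (m : ℕ) :
    coeff m (X * derivative ℝ g) = m * coeff m g := by
  cases m with
  | zero => simp
  | succ m => rw [coeff_succ_X_mul, coeff_derivative]; push_cast; ring

/-- Lagrange inversion for the series with `G = X * f(G)`, the functional equation being expressed
through coefficients. -/
theorem PowerSeries.lagrange_of_recursion {f G : ℝ⟦X⟧} (hG0 : coeff 0 G = 0)
    (hG : ∀ n, coeff (n + 1) G = ∑ j ∈ range (n + 1), coeff j f * coeff n (G ^ j)) (n k : ℕ) :
    (n : ℝ) * coeff n (G ^ k) = k * coeff n (X ^ k * f ^ n) := by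
  induction n generalizing k with
  | zero => cases k <;> simp [coeff_zero_eq_constantCoeff]
  | succ n ih =>
    cases k with
    | zero => simp [coeff_one]
    | succ k =>
      rw [coeff_succ_pow_succ_of_recursion hG0 hG, pow_succ' X k, mul_assoc, coeff_succ_X_mul]
      rcases Nat.eq_zero_or_pos n with rfl | hn
      · have hG0' : constantCoeff G = 0 := by rwa [← coeff_zero_eq_constantCoeff_apply]
        cases k <;> simp [hG0']
      have hn' : (n : ℝ) ≠ 0 := by positivity
      -- The induction hypothesis controls `n * coeff n`, so a factor `n` is inserted; this is why
      -- `n = 0` was treated apart.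
      apply mul_left_cancel₀ hn'
      have h1 : (n : ℝ) * (((n + 1 : ℕ) : ℝ) *
            ∑ j ∈ range (n + 1), coeff j f * coeff n (G ^ (k + j))) =
          (n + 1) * ∑ j ∈ range (n + 1), coeff j f * ((k + j) * coeff n (X ^ (k + j) * f ^ n)) := by
        rw [mul_left_comm, mul_sum]
        push_cast
        congr 1
        refine sum_congr rfl fun j _ => ?_
        rw [mul_left_comm, ih]
        push_cast
        ring
      rw [h1]
      -- For `n < k` both sides vanish by order; otherwise `n = k + m` and the powers of `X` can be
      -- stripped.
      rcases lt_or_ge n k with hk | hk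
      · rw [coeff_X_pow_mul', if_neg (by omega), sum_eq_zero]
        · simp
        · intro j _
          rw [coeff_X_pow_mul', if_neg (by omega)]
          simp
      obtain ⟨m, rfl⟩ := Nat.exists_eq_add_of_le hk
      have h2 : ∑ j ∈ range (k + m + 1),
            coeff j f * ((k + j) * coeff (k + m) (X ^ (k + j) * f ^ (k + m))) =
          ∑ p ∈ antidiagonal m, coeff p.1 f * ((k + p.1) * coeff p.2 (f ^ (k + m))) := by
        rw [Nat.sum_antidiagonal_eq_sum_range_succ
          (fun a b => coeff a f * ((k + a) * coeff b (f ^ (k + m))))]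
        symm
        refine sum_subset_zero_on_sdiff (range_subset_range.2 (by omega)) ?_ ?_
        · intro j hj
          rw [coeff_X_pow_mul', if_neg (by simp at hj; omega)]
          simp
        · intro j hj
          rw [coeff_X_pow_mul', if_pos (by simp at hj; omega)]
          congr 4
          omega
      -- The weight `p.1` on the coefficients of `f` is the Euler operator `X * d/dX`.
      have h3 : ∑ p ∈ antidiagonal m, coeff p.1 f * ((k + p.1) * coeff p.2 (f ^ (k + m))) =
          k * coeff m (f ^ (k + m + 1)) + coeff m (X * derivative ℝ f * f ^ (k + m)) := by
        rw [pow_succ' f, coeff_mul, coeff_mul, mul_sum, ← sum_add_distrib]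
        refine sum_congr rfl fun p _ => ?_
        rw [coeff_X_mul_derivative]
        ring
      -- From `(n+1) f' f^n = (f^(n+1))'`. The total factor is then `(n+1)k + m = n(k+1)`, as `n = k
      -- + m`.
      have h4 : ((k + m : ℕ) + 1 : ℝ) * coeff m (X * derivative ℝ f * f ^ (k + m)) =
          m * coeff m (f ^ (k + m + 1)) := by
        rw [← coeff_X_mul_derivative, Derivation.leibniz_pow, ← coeff_C_mul]
        congr 1
        simp only [smul_eq_mul, nsmul_eq_mul]
        push_cast
        simp only [map_add, map_natCast, map_one]
        ring
      rw [h2, h3, mul_add, h4, coeff_X_pow_mul', if_pos (by omega)]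
      push_cast
      simp
      ring

end PowerSeries

/-! ### Family trees and their decomposition at the root. -/

section Tree

/-- The label `u` is a node of the family tree in which the individual with label `v` has `η v`
children, labelled `0 :: v`, ..., `(η v - 1) :: v`. -/
def IsNode (η : List ℕ → ℕ) : List ℕ → Prop
  | [] => True
  | k :: u => IsNode η u ∧ k < η u

/-- The number of nodes of the family tree with offspring numbers `η`. -/
noncomputable def treeSize (η : List ℕ → ℕ) : ℕ∞ :=
  {u | IsNode η u}.encard

/-- The offspring numbers in the subtree of the descendants of the `k`-th child of the root. -/
def subtree (k : ℕ) (η : List ℕ → ℕ) : List ℕ → ℕ :=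
  fun u => η (u ++ [k])

theorem isNode_append_singleton (η : List ℕ → ℕ) (k : ℕ) (u : List ℕ) :
    IsNode η (u ++ [k]) ↔ k < η [] ∧ IsNode (subtree k η) u := by
  induction u with
  | nil => simp [IsNode]
  | cons j u ih => simp [IsNode, ih, subtree, and_assoc]

theorem tsum_list_cons (f : List ℕ → ℝ≥0∞) :
    ∑' u, f u = f [] + ∑' u, ∑' k, f (k :: u) := by
  let e : Unit ⊕ (List ℕ × ℕ) ≃ List ℕ :=
    { toFun := Sum.elim (fun _ => []) fun p => p.2 :: p.1
      invFun := fun u => match u with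
        | [] => Sum.inl ()
        | k :: u => Sum.inr (u, k)
      left_inv := by rintro (_ | ⟨u, k⟩) <;> rfl
      right_inv := by rintro (_ | ⟨k, u⟩) <;> rfl }
  rw [← e.tsum_eq, Summable.tsum_sum ENNReal.summable ENNReal.summable, tsum_fintype,
    Finset.univ_unique, Finset.sum_singleton]
  congr 1
  exact ENNReal.tsum_prod (f := fun u k => f (k :: u))

/-- The last entry of a label names the child of the root it descends from, so this splits a sum
over labels by first-generation ancestor. List reversal reduces it to `tsum_list_cons`. -/
theorem tsum_list_append_singleton (f : List ℕ → ℝ≥0∞) :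
    ∑' u, f u = f [] + ∑' k, ∑' u, f (u ++ [k]) := by
  let e : List ℕ ≃ List ℕ := List.reverse_involutive.toPerm
  rw [← e.tsum_eq, tsum_list_cons, ENNReal.tsum_comm]
  congr 1
  refine tsum_congr fun k => ?_
  rw [← e.tsum_eq]
  refine tsum_congr fun u => ?_
  simp [e]

open scoped Classical in
theorem toENNReal_treeSize (η : List ℕ → ℕ) :
    (treeSize η : ℝ≥0∞) = ∑' u, if IsNode η u then 1 else 0 := by
  rw [treeSize, ← ENNReal.tsum_set_one, tsum_subtype {u | IsNode η u} fun _ => (1 : ℝ≥0∞)]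
  rfl

/-- The nodes other than the root are partitioned by their ancestor in the first generation. The
count is done in `ℝ≥0∞`, where all sums converge. -/
theorem treeSize_eq_one_add (η : List ℕ → ℕ) :
    treeSize η = 1 + ∑ k ∈ Finset.range (η []), treeSize (subtree k η) := by
  classical
  apply ENat.toENNReal_strictMono.injective
  have hsum : ∀ s : Finset ℕ, ((∑ k ∈ s, treeSize (subtree k η) : ℕ∞) : ℝ≥0∞) =
      ∑ k ∈ s, (treeSize (subtree k η) : ℝ≥0∞) := fun s =>
    map_sum ENat.toENNRealRingHom _ s
  rw [ENat.toENNReal_add, ENat.toENNReal_one, hsum, toENNReal_treeSize,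
    tsum_list_append_singleton, if_pos (by trivial)]
  congr 1
  rw [tsum_eq_sum (s := Finset.range (η []))]
  · refine Finset.sum_congr rfl fun k hk => ?_
    rw [toENNReal_treeSize]
    refine tsum_congr fun u => ?_
    simp [isNode_append_singleton, Finset.mem_range.1 hk]
  · intro k hk
    simp only [Finset.mem_range] at hk
    simp [isNode_append_singleton, hk]

theorem one_le_treeSize (η : List ℕ → ℕ) : 1 ≤ treeSize η := by
  rw [treeSize_eq_one_add]
  exact le_self_add

theorem measurableSet_isNode (u : List ℕ) : MeasurableSet {η | IsNode η u} := by
  induction u with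
  | nil => simp [IsNode]
  | cons k u ih =>
    exact ih.inter (measurableSet_lt measurable_const (measurable_pi_apply u))

theorem measurable_treeSize : Measurable treeSize := by
  classical
  have h : Measurable fun η => (treeSize η : ℝ≥0∞) := by
    simp_rw [toENNReal_treeSize]
    exact Measurable.tsum fun u =>
      Measurable.ite (measurableSet_isNode u) measurable_const measurable_const
  refine measurable_to_countable' fun n => ?_
  convert! h (measurableSet_singleton (n : ℝ≥0∞)) using 1
  ext η
  simp

end Tree

/-! ### Total progeny of a Galton-Watson tree. -/

section GaltonWatson

/-- The law of the offspring numbers of a Galton-Watson tree with offspring distribution `ν`. -/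
noncomputable def offspringLaw (ν : Measure ℕ) : Measure (List ℕ → ℕ) :=
  Measure.infinitePi fun _ => ν

/-- The σ-algebra generated by the offspring numbers of the individuals in `S`. -/
@[reducible]
def offspringSigma (S : Set (List ℕ)) : MeasurableSpace (List ℕ → ℕ) :=
  ⨆ u ∈ S, MeasurableSpace.comap (fun η : List ℕ → ℕ => η u) inferInstance

theorem measurable_offspringSigma_apply {S : Set (List ℕ)} {u : List ℕ} (hu : u ∈ S) :
    Measurable[offspringSigma S] fun η : List ℕ → ℕ => η u :=
  (comap_measurable (fun η : List ℕ → ℕ => η u)).mono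
    (le_iSup₂_of_le (f := fun u (_ : u ∈ S) =>
      MeasurableSpace.comap (fun η : List ℕ → ℕ => η u) inferInstance) u hu le_rfl) le_rfl

theorem measurable_offspringSigma_subtree {S : Set (List ℕ)} {k : ℕ} (hS : ∀ u, u ++ [k] ∈ S) :
    Measurable[offspringSigma S] (subtree k) := by
  exact @measurable_pi_lambda _ _ _ (offspringSigma S) _ _
    fun u => measurable_offspringSigma_apply (hS u)

theorem measurable_offspringSigma_treeSize_subtree {S : Set (List ℕ)} {k : ℕ}
    (hS : ∀ u, u ++ [k] ∈ S) :
    Measurable[offspringSigma S] fun η => treeSize (subtree k η) :=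
  measurable_treeSize.comp (measurable_offspringSigma_subtree hS)

theorem measurable_offspringSigma_sum_treeSize {S : Set (List ℕ)} (j : ℕ)
    (hS : ∀ u, ∀ k < j, u ++ [k] ∈ S) :
    Measurable[offspringSigma S] fun η => ∑ k ∈ Finset.range j, treeSize (subtree k η) :=
  Finset.measurable_fun_sum _ fun k hk =>
    measurable_offspringSigma_treeSize_subtree fun u => hS u k (Finset.mem_range.1 hk)

/-- Being a node depends only on the offspring numbers of strict ancestors, whose labels are
shorter; hence it is independent of `η u`. -/
theorem measurableSet_offspringSigma_isNode {S : Set (List ℕ)} (u : List ℕ)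
    (hS : ∀ v : List ℕ, v.length < u.length → v ∈ S) :
    MeasurableSet[offspringSigma S] {η | IsNode η u} := by
  induction u with
  | nil => simp [IsNode]
  | cons k u ih =>
    have h1 := ih fun v hv => hS v (hv.trans (by simp))
    have h2 : MeasurableSet[offspringSigma S] {η : List ℕ → ℕ | k < η u} :=
      measurable_offspringSigma_apply (hS u (by simp)) (measurableSet_Ioi (a := k))
    exact MeasurableSet.inter h1 h2

variable (ν : Measure ℕ)

instance [IsProbabilityMeasure ν] : IsProbabilityMeasure (offspringLaw ν) := by
  unfold offspringLaw
  infer_instance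

theorem offspringLaw_map_apply [IsProbabilityMeasure ν] (u : List ℕ) :
    (offspringLaw ν).map (fun η => η u) = ν :=
  Measure.infinitePi_map_eval (fun _ => ν) u

theorem iIndepFun_offspringLaw [IsProbabilityMeasure ν] :
    iIndepFun (fun (u : List ℕ) (η : List ℕ → ℕ) => η u) (offspringLaw ν) := by
  rw [iIndepFun_iff_map_fun_eq_infinitePi_map fun u => measurable_pi_apply u]
  simp_rw [offspringLaw_map_apply]
  exact Measure.map_id

theorem offspringLaw_map_subtree [IsProbabilityMeasure ν] (k : ℕ) :
    (offspringLaw ν).map (subtree k) = offspringLaw ν := by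
  have h := (iIndepFun_offspringLaw ν).precomp
    (g := fun u : List ℕ => u ++ [k]) (List.append_left_injective [k])
  have h' := h.map_fun_eq_infinitePi_map fun u => measurable_pi_apply _
  simp_rw [offspringLaw_map_apply] at h'
  exact h'

theorem offspringLaw_inter [IsProbabilityMeasure ν] {S T : Set (List ℕ)} (hST : Disjoint S T)
    {A B : Set (List ℕ → ℕ)}
    (hA : MeasurableSet[offspringSigma S] A) (hB : MeasurableSet[offspringSigma T] B) :
    offspringLaw ν (A ∩ B) = offspringLaw ν A * offspringLaw ν B :=
  (Indep_iff _ _ _).1 (indep_iSup_of_disjoint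
    (fun u => (measurable_pi_apply u).comap_le) (iIndepFun_offspringLaw ν) hST) A B hA hB

theorem measurable_subtree (k : ℕ) : Measurable (subtree k) :=
  measurable_pi_iff.2 fun _ => measurable_pi_apply _

theorem measurableSet_treeSize_eq (n : ℕ∞) : MeasurableSet {η | treeSize η = n} :=
  measurable_treeSize (measurableSet_singleton n)

/-- The generating function of the total progeny. -/
noncomputable def progenySeries : PowerSeries ℝ :=
  PowerSeries.mk fun n => (offspringLaw ν).real {η | treeSize η = n}

/-- The generating function of the offspring distribution. -/
noncomputable def offspringSeries : PowerSeries ℝ :=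
  PowerSeries.mk fun n => ν.real {n}

theorem ENat.setOf_add_eq_natCast {α : Type*} (f g : α → ℕ∞) (n : ℕ) :
    {x | f x + g x = n} =
      ⋃ p ∈ Finset.HasAntidiagonal.antidiagonal n, {x | f x = (p.1 : ℕ)} ∩ {x | g x = (p.2 : ℕ)} := by
  ext x
  simp only [mem_ofPred_eq, Finset.HasAntidiagonal.mem_antidiagonal, mem_iUnion,
    mem_inter_iff, exists_prop,
    Prod.exists]
  constructor
  · intro h
    obtain ⟨a, ha⟩ := ENat.ne_top_iff_exists.1
      (ne_top_of_le_ne_top (ENat.natCast_ne_top n) (h ▸ le_self_add : f x ≤ n))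
    obtain ⟨b, hb⟩ := ENat.ne_top_iff_exists.1
      (ne_top_of_le_ne_top (ENat.natCast_ne_top n) (h ▸ le_add_self : g x ≤ n))
    rw [← ha, ← hb] at h
    exact ⟨a, b, by exact_mod_cast h, ha.symm, hb.symm⟩
  · rintro ⟨a, b, rfl, ha, hb⟩
    rw [ha, hb, Nat.cast_add]

theorem measurable_sum_treeSize (j : ℕ) :
    Measurable fun η => ∑ k ∈ Finset.range j, treeSize (subtree k η) :=
  Finset.measurable_fun_sum _ fun k _ => measurable_treeSize.comp (measurable_subtree k)

/-- The subtrees of distinct children read disjoint sets of labels, so their sizes are i.i.d. copies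
of the tree size, and sums correspond to products of generating functions. -/
theorem offspringLaw_real_sum_treeSize [IsProbabilityMeasure ν] (j n : ℕ) :
    (offspringLaw ν).real {η | ∑ k ∈ Finset.range j, treeSize (subtree k η) = n} =
      PowerSeries.coeff n (progenySeries ν ^ j) := by
  induction j generalizing n with
  | zero =>
    rcases Nat.eq_zero_or_pos n with rfl | hn
    · simp
    · have : ¬ (0 : ℕ∞) = n := by exact_mod_cast hn.ne
      simp [this, PowerSeries.coeff_one, hn.ne']
  | succ j ih =>
    simp_rw [Finset.sum_range_succ]
    rw [ENat.setOf_add_eq_natCast, measureReal_biUnion_finset, pow_succ, PowerSeries.coeff_mul]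
    · refine Finset.sum_congr rfl fun p _ => ?_
      rw [← ih, progenySeries, PowerSeries.coeff_mk]
      have hdisj : Disjoint {u : List ℕ | ∃ v, ∃ k < j, u = v ++ [k]}
          {u : List ℕ | ∃ v, u = v ++ [j]} := by
        rw [Set.disjoint_left]
        rintro u ⟨v, k, hk, rfl⟩ ⟨w, hw⟩
        have := (List.append_inj' hw rfl).2
        simp at this
        omega
      have hsub : offspringLaw ν {η | treeSize (subtree j η) = (p.2 : ℕ)} =
          offspringLaw ν {η | treeSize η = (p.2 : ℕ)} := by
        conv_rhs => rw [← offspringLaw_map_subtree ν j]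
        rw [Measure.map_apply (measurable_subtree j) (measurableSet_treeSize_eq _)]
        rfl
      rw [measureReal_def, offspringLaw_inter ν hdisj, ENNReal.toReal_mul, hsub]
      · rfl
      · exact measurable_offspringSigma_sum_treeSize
          (S := {u : List ℕ | ∃ v, ∃ k < j, u = v ++ [k]}) j (fun u k hk => ⟨u, k, hk, rfl⟩)
          (measurableSet_singleton _)
      · exact measurable_offspringSigma_treeSize_subtree
          (S := {u : List ℕ | ∃ v, u = v ++ [j]}) (fun u => ⟨u, rfl⟩)
          (measurableSet_singleton _)
    · intro p hp q hq hpq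
      rw [Function.onFun, Set.disjoint_left]
      rintro η ⟨h1, h2⟩ ⟨h3, h4⟩
      simp only [mem_ofPred_eq] at h1 h2 h3 h4
      rw [h1] at h3
      rw [h2] at h4
      exact hpq (Prod.ext (by exact_mod_cast h3) (by exact_mod_cast h4))
    · exact fun p _ => (measurable_sum_treeSize j (measurableSet_singleton _)).inter
        ((measurable_treeSize.comp (measurable_subtree j)) (measurableSet_singleton _))

theorem coeff_zero_progenySeries : PowerSeries.coeff 0 (progenySeries ν) = 0 := by
  have : {η | treeSize η = ((0 : ℕ) : ℕ∞)} = ∅ := by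
    ext η
    have := one_le_treeSize η
    simp only [mem_ofPred_eq, mem_empty_iff_false, iff_false, Nat.cast_zero]
    exact (zero_lt_one.trans_le this).ne'
  rw [progenySeries, PowerSeries.coeff_mk, this, measureReal_empty]

/-- Condition on the number `j` of children of the root, which is independent of the subtrees. Each
subtree has at least one node, whence `j ≤ n`. -/
theorem coeff_succ_progenySeries [IsProbabilityMeasure ν] (n : ℕ) :
    PowerSeries.coeff (n + 1) (progenySeries ν) = ∑ j ∈ Finset.range (n + 1),
      PowerSeries.coeff j (offspringSeries ν) * PowerSeries.coeff n (progenySeries ν ^ j) := by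
  have hset : {η | treeSize η = ((n + 1 : ℕ) : ℕ∞)} = ⋃ j ∈ Finset.range (n + 1),
      {η : List ℕ → ℕ | η [] = j} ∩ {η | ∑ k ∈ Finset.range j, treeSize (subtree k η) = n} := by
    ext η
    simp only [mem_ofPred_eq, mem_iUnion, mem_inter_iff, exists_prop, Finset.mem_range]
    rw [treeSize_eq_one_add, Nat.cast_succ, add_comm,
      (ENat.add_left_injective_of_ne_top ENat.one_ne_top).eq_iff]
    constructor
    · refine fun h => ⟨η [], ?_, rfl, h⟩
      have h1 : ((η [] : ℕ) : ℕ∞) ≤ n := by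
        rw [← h]
        simpa using Finset.card_nsmul_le_sum (Finset.range (η []))
          (fun k => treeSize (subtree k η)) 1 fun k _ => one_le_treeSize _
      have h2 : η [] ≤ n := by exact_mod_cast h1
      omega
    · rintro ⟨j, -, rfl, h⟩
      exact h
  have hdisj : Disjoint {([] : List ℕ)} {u : List ℕ | u ≠ []} := by
    rw [Set.disjoint_left]
    simp
  rw [progenySeries, PowerSeries.coeff_mk, hset, measureReal_biUnion_finset]
  · refine Finset.sum_congr rfl fun j _ => ?_
    rw [← progenySeries, ← offspringLaw_real_sum_treeSize, measureReal_def,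
      offspringLaw_inter ν hdisj, ENNReal.toReal_mul, offspringSeries, PowerSeries.coeff_mk]
    · congr 1
      conv_rhs => rw [← offspringLaw_map_apply ν [], measureReal_def,
        Measure.map_apply (measurable_pi_apply _) (measurableSet_singleton _)]
      rfl
    · exact measurable_offspringSigma_apply (Set.mem_singleton _) (measurableSet_singleton j)
    · exact measurable_offspringSigma_sum_treeSize j (fun u k _ => by simp)
        (measurableSet_singleton _)
  · intro i _ j _ hij
    rw [Function.onFun, Set.disjoint_left]
    rintro η ⟨h1, -⟩ ⟨h2, -⟩
    exact hij (h1.symm.trans h2)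
  · exact fun j _ => (measurable_pi_apply (X := fun _ : List ℕ => ℕ) []
        (measurableSet_singleton j)).inter
      (measurable_sum_treeSize j (measurableSet_singleton _))

/-- The Otter-Dwass formula for the total progeny of a Galton-Watson process. -/
theorem offspringLaw_real_treeSize_eq [IsProbabilityMeasure ν] (n : ℕ) :
    (offspringLaw ν).real {η | treeSize η = ((n + 1 : ℕ) : ℕ∞)} =
      1 / ((n + 1 : ℕ) : ℝ) * PowerSeries.coeff n (offspringSeries ν ^ (n + 1)) := by
  have h := PowerSeries.lagrange_of_recursion (coeff_zero_progenySeries ν)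
    (coeff_succ_progenySeries ν) (n + 1) 1
  rw [pow_one, pow_one, PowerSeries.coeff_succ_X_mul, Nat.cast_one, one_mul] at h
  rw [← h, progenySeries, PowerSeries.coeff_mk]
  have : ((n + 1 : ℕ) : ℝ) ≠ 0 := by positivity
  field_simp

/-- The mean size of generation `g` is the `g`-th power of the mean offspring number, written as a
sum of tails: `k :: u` is a node iff `u` is one and `η u > k`, and these two events are independent.
-/
theorem tsum_offspringLaw_isNode_of_length [IsProbabilityMeasure ν] (g : ℕ) :
    ∑' u : List ℕ, (if u.length = g then offspringLaw ν {η | IsNode η u} else 0) =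
      (∑' k, ν (Ioi k)) ^ g := by
  induction g with
  | zero =>
    rw [tsum_list_cons]
    simp [IsNode]
  | succ g ih =>
    rw [tsum_list_cons, pow_succ, ← ih, ← ENNReal.tsum_mul_right]
    simp only [List.length_nil, (Nat.succ_ne_zero g).symm, if_false, zero_add, List.length_cons,
      Nat.add_right_cancel_iff]
    refine tsum_congr fun u => ?_
    split_ifs with hu
    · rw [← ENNReal.tsum_mul_left]
      refine tsum_congr fun k => ?_
      have hdisj : Disjoint {v : List ℕ | v.length < u.length} {u} := by simp
      have h := offspringLaw_inter ν hdisj (measurableSet_offspringSigma_isNode u fun v hv => hv)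
        (measurable_offspringSigma_apply (Set.mem_singleton u) (measurableSet_Ioi (a := k)))
      have h' : offspringLaw ν ((fun η : List ℕ → ℕ => η u) ⁻¹' Ioi k) = ν (Ioi k) := by
        rw [← Measure.map_apply (measurable_pi_apply u) measurableSet_Ioi, offspringLaw_map_apply]
      rw [h'] at h
      exact h
    · simp

theorem ae_treeSize_lt_top [IsProbabilityMeasure ν] (hν : ∑' k, ν (Ioi k) < 1) :
    ∀ᵐ η ∂offspringLaw ν, treeSize η < ⊤ := by
  classical
  have hint : ∫⁻ η, (treeSize η : ℝ≥0∞) ∂offspringLaw ν = (1 - ∑' k, ν (Ioi k))⁻¹ := by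
    simp_rw [toENNReal_treeSize]
    rw [lintegral_tsum fun u => (Measurable.ite (measurableSet_isNode u) measurable_const
      measurable_const).aemeasurable, ← ENNReal.tsum_geometric]
    simp_rw [← tsum_offspringLaw_isNode_of_length]
    rw [ENNReal.tsum_comm]
    refine tsum_congr fun u => ?_
    -- Each label contributes to one generation only, that of its length.
    rw [tsum_eq_single u.length fun g hg => if_neg hg.symm, if_pos rfl]
    exact lintegral_indicator_one (measurableSet_isNode u)
  have hmeas : Measurable fun η => (treeSize η : ℝ≥0∞) :=
    (measurable_of_countable _).comp measurable_treeSize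
  filter_upwards [ae_lt_top hmeas (by
    rw [hint]
    exact ENNReal.inv_ne_top.2 (tsub_pos_of_lt hν).ne')] with η hη
  simpa using hη

end GaltonWatson

/-! ### The series `(1 - q x)^(-a)`. -/

section NegativeBinomial

open PowerSeries

theorem Ring.multichoose_eq_Gamma_div {a : ℝ} (ha : 0 < a) (k : ℕ) :
    Ring.multichoose a k = Real.Gamma (a + k) / (k.factorial * Real.Gamma a) := by
  have hfac : (k.factorial : ℝ) ≠ 0 := by positivity
  have hG : Real.Gamma a ≠ 0 := (Real.Gamma_pos_of_pos ha).ne'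
  have h := Ring.factorial_nsmul_multichoose_eq_ascPochhammer a k
  rw [nsmul_eq_mul] at h
  have h2 : (ascPochhammer ℕ k).smeval a * Real.Gamma a = Real.Gamma (a + k) := by
    clear h hfac
    induction k with
    | zero => simp [Polynomial.smeval_one]
    | succ k ih =>
      have hpos : a + k ≠ 0 := by positivity
      rw [Nat.cast_succ, ← add_assoc, Real.Gamma_add_one hpos, ← ih, ascPochhammer_succ_right,
        Polynomial.smeval_mul, Polynomial.smeval_add, Polynomial.smeval_X,
        Polynomial.smeval_natCast]
      simp
      ring
  rw [eq_div_iff (by positivity), ← h2, ← h]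
  ring

/-- The generating function of the coefficients `Γ(a + k) / (k! Γ(a)) * q ^ k`. -/
noncomputable def negBinomialSeries (q a : ℝ) : PowerSeries ℝ :=
  rescale (-q) (binomialSeries ℝ (-a))

theorem coeff_negBinomialSeries (q : ℝ) {a : ℝ} (ha : 0 < a) (k : ℕ) :
    coeff k (negBinomialSeries q a) =
      Real.Gamma (a + k) / (k.factorial * Real.Gamma a) * q ^ k := by
  rw [negBinomialSeries, coeff_rescale, binomialSeries_coeff, Ring.choose_neg',
    Ring.multichoose_eq_Gamma_div ha, neg_pow q]
  have : Int.negOnePow (k : ℤ) • (Real.Gamma (a + k) / (k.factorial * Real.Gamma a)) =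
      (-1) ^ k * (Real.Gamma (a + k) / (k.factorial * Real.Gamma a)) := by
    rw [Int.negOnePow_def, Units.smul_def]
    simp
  rw [this, smul_eq_mul, mul_one]
  have h1 : ((-1 : ℝ) ^ k) * (-1) ^ k = 1 := by rw [← mul_pow]; simp
  linear_combination (q ^ k * (Real.Gamma (a + k) / (k.factorial * Real.Gamma a))) * h1

/-- The series is `(1 - q x)^(-a)`, so exponents add under multiplication. -/
theorem negBinomialSeries_pow (q a : ℝ) (n : ℕ) :
    negBinomialSeries q a ^ n = negBinomialSeries q (n * a) := by
  induction n with
  | zero => simp [negBinomialSeries]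
  | succ n ih =>
    rw [pow_succ, ih, negBinomialSeries, negBinomialSeries, ← map_mul, ← binomialSeries_add,
      negBinomialSeries]
    congr 2
    push_cast
    ring

end NegativeBinomial

/-! ### Gamma mixtures of Poisson laws. -/

section MixedPoisson

/-- The mixed Poisson distribution whose parameter is `ρ` times a gamma distributed variable. -/
noncomputable def gammaPoissonMeasure (α c ρ : ℝ) : Measure ℕ :=
  (gammaMeasure α c).bind fun b => poissonMeasure (b * ρ).toNNReal

theorem measurable_poissonMeasure_toNNReal (ρ : ℝ) :
    Measurable fun b : ℝ => poissonMeasure (b * ρ).toNNReal := by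
  refine Measure.measurable_of_measurable_coe _ fun s _ => ?_
  have : ∀ b : ℝ, poissonMeasure (b * ρ).toNNReal s =
      ∑' n : ℕ, ENNReal.ofReal (Real.exp (-((b * ρ).toNNReal : ℝ)) *
        ((b * ρ).toNNReal : ℝ) ^ n / n.factorial) * s.indicator 1 n := by
    intro b
    rw [poissonMeasure, Measure.sum_apply _ (MeasurableSet.of_discrete)]
    simp
  simp_rw [this]
  refine Measurable.tsum fun n => ?_
  fun_prop

theorem lintegral_gammaMeasure {α c : ℝ} (f : ℝ → ℝ≥0∞) (hf : Measurable f) :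
    ∫⁻ b, f b ∂gammaMeasure α c = ∫⁻ b, gammaPDF α c b * f b := by
  rw [gammaMeasure, lintegral_withDensity_eq_lintegral_mul _ (by unfold gammaPDF; fun_prop) hf]
  rfl

theorem gammaMeasure_ae_pos {α c : ℝ} : ∀ᵐ b ∂gammaMeasure α c, 0 < b := by
  have hm : Measurable (gammaPDF α c) := by unfold gammaPDF; fun_prop
  rw [gammaMeasure, ae_withDensity_iff hm]
  have h0 : ∀ᵐ b : ℝ, b ≠ 0 := by simp [ae_iff, measure_singleton]
  filter_upwards [h0] with b hb hpdf
  by_contra! h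
  exact hpdf (gammaPDF_of_neg (lt_of_le_of_ne h hb))

theorem gammaPoissonMeasure_apply (α c ρ : ℝ) (s : Set ℕ) :
    gammaPoissonMeasure α c ρ s =
      ∫⁻ b, poissonMeasure (b * ρ).toNNReal s ∂gammaMeasure α c :=
  Measure.bind_apply MeasurableSet.of_discrete
    (measurable_poissonMeasure_toNNReal ρ).aemeasurable

theorem isProbabilityMeasure_gammaPoissonMeasure {α c : ℝ} (hα : 0 < α) (hc : 0 < c) (ρ : ℝ) :
    IsProbabilityMeasure (gammaPoissonMeasure α c ρ) := by
  have := isProbabilityMeasure_gammaMeasure hα hc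
  constructor
  rw [gammaPoissonMeasure_apply]
  simp

/-- Exponential tilting: the factor `b^k e^(-ρb)` raises the shape by `k` and the rate by `ρ`, up to
the ratio of normalising constants. -/
theorem gammaPDF_mul_pow_mul_exp {α c ρ : ℝ} (hα : 0 < α) (hc : 0 < c) (hρ : 0 ≤ ρ) (k : ℕ)
    {b : ℝ} (hb : 0 < b) :
    gammaPDF α c b * ENNReal.ofReal (b ^ k * Real.exp (-(ρ * b))) =
      ENNReal.ofReal (Real.Gamma (α + k) / Real.Gamma α * c ^ α / (c + ρ) ^ (α + k)) *
        gammaPDF (α + k) (c + ρ) b := by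
  have hG := Real.Gamma_pos_of_pos hα
  have hG' : 0 < Real.Gamma (α + k) := Real.Gamma_pos_of_pos (by positivity)
  have hp : 0 < (c + ρ) ^ (α + k) := by positivity
  rw [gammaPDF_of_nonneg hb.le, gammaPDF_of_nonneg hb.le, ← ENNReal.ofReal_mul (by positivity),
    ← ENNReal.ofReal_mul (by positivity)]
  congr 1
  have h1 : b ^ (α + k - 1) = b ^ (α - 1) * b ^ k := by
    rw [← Real.rpow_natCast, ← Real.rpow_add hb]
    congr 1
    ring
  have h2 : Real.exp (-((c + ρ) * b)) = Real.exp (-(c * b)) * Real.exp (-(ρ * b)) := by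
    rw [← Real.exp_add]
    congr 1
    ring
  rw [h1, h2]
  field_simp

theorem lintegral_pow_mul_exp_gammaMeasure {α c ρ : ℝ} (hα : 0 < α) (hc : 0 < c) (hρ : 0 ≤ ρ)
    (k : ℕ) :
    ∫⁻ b, ENNReal.ofReal (b ^ k * Real.exp (-(ρ * b))) ∂gammaMeasure α c =
      ENNReal.ofReal (Real.Gamma (α + k) / Real.Gamma α * c ^ α / (c + ρ) ^ (α + k)) := by
  rw [lintegral_gammaMeasure _ (by fun_prop)]
  have h0 : ∀ᵐ b : ℝ, b ≠ 0 := by simp [ae_iff, measure_singleton]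
  have : ∀ᵐ b : ℝ, gammaPDF α c b * ENNReal.ofReal (b ^ k * Real.exp (-(ρ * b))) =
      ENNReal.ofReal (Real.Gamma (α + k) / Real.Gamma α * c ^ α / (c + ρ) ^ (α + k)) *
        gammaPDF (α + k) (c + ρ) b := by
    filter_upwards [h0] with b hb
    rcases lt_or_gt_of_ne hb with h | h
    · rw [gammaPDF_of_neg h, gammaPDF_of_neg h]
      simp
    · exact gammaPDF_mul_pow_mul_exp hα hc hρ k h
  rw [lintegral_congr_ae this, lintegral_const_mul _ (by unfold gammaPDF; fun_prop),
    lintegral_gammaPDF_eq_one (by positivity) (by positivity), mul_one]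

theorem gammaPoissonMeasure_real_singleton {α c ρ : ℝ} (hα : 0 < α) (hc : 0 < c) (hρ : 0 ≤ ρ)
    (k : ℕ) :
    (gammaPoissonMeasure α c ρ).real {k} = (c / (c + ρ)) ^ α *
      (Real.Gamma (α + k) / (k.factorial * Real.Gamma α) * (ρ / (c + ρ)) ^ k) := by
  have hG := Real.Gamma_pos_of_pos hα
  have hG' : 0 < Real.Gamma (α + k) := Real.Gamma_pos_of_pos (by positivity)
  have h1 : gammaPoissonMeasure α c ρ {k} = ENNReal.ofReal (ρ ^ k / k.factorial) *
      ∫⁻ b, ENNReal.ofReal (b ^ k * Real.exp (-(ρ * b))) ∂gammaMeasure α c := by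
    rw [gammaPoissonMeasure_apply, ← lintegral_const_mul _ (by fun_prop)]
    refine lintegral_congr_ae ?_
    filter_upwards [gammaMeasure_ae_pos] with b hb
    rw [poissonMeasure_singleton, Real.coe_toNNReal _ (by positivity),
      ← ENNReal.ofReal_mul (by positivity)]
    congr 1
    rw [mul_comm b ρ, mul_pow]
    ring
  rw [measureReal_def, h1, lintegral_pow_mul_exp_gammaMeasure hα hc hρ,
    ← ENNReal.ofReal_mul (by positivity), ENNReal.toReal_ofReal (by positivity),
    Real.div_rpow hc.le (by positivity), Real.rpow_add (by positivity), Real.rpow_natCast, div_pow]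
  field_simp

theorem offspringSeries_gammaPoissonMeasure {α c ρ : ℝ} (hα : 0 < α) (hc : 0 < c) (hρ : 0 ≤ ρ) :
    offspringSeries (gammaPoissonMeasure α c ρ) =
      PowerSeries.C ((c / (c + ρ)) ^ α) * negBinomialSeries (ρ / (c + ρ)) α := by
  ext k
  rw [offspringSeries, PowerSeries.coeff_mk, gammaPoissonMeasure_real_singleton hα hc hρ,
    PowerSeries.coeff_C_mul, coeff_negBinomialSeries _ hα]

theorem tsum_measure_Ioi (μ : Measure ℕ) : ∑' k, μ (Ioi k) = ∫⁻ n, (n : ℝ≥0∞) ∂μ := by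
  have h : ∀ n : ℕ, (n : ℝ≥0∞) = ∑' k, (Ioi k).indicator 1 n := by
    intro n
    rw [tsum_eq_sum (s := Finset.range n)]
    · rw [Finset.sum_congr rfl (g := fun _ => 1)]
      · simp
      · exact fun k hk => indicator_of_mem (Finset.mem_range.1 hk) _
    · exact fun k hk => indicator_of_notMem (fun h => hk (Finset.mem_range.2 h)) _
  simp_rw [h]
  rw [lintegral_tsum fun k => (measurable_of_countable _).aemeasurable]
  exact tsum_congr fun k => (lintegral_indicator_one measurableSet_Ioi).symm

theorem lintegral_natCast_poissonMeasure (r : ℝ≥0) :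
    ∫⁻ n, (n : ℝ≥0∞) ∂poissonMeasure r = r := by
  have hterm : ∀ n : ℕ, ENNReal.ofReal (Real.exp (-r) * r ^ (n + 1) / (n + 1).factorial) *
      ((n + 1 : ℕ) : ℝ≥0∞) = r * ENNReal.ofReal (Real.exp (-r) * r ^ n / n.factorial) := by
    intro n
    rw [← ENNReal.ofReal_natCast, ← ENNReal.ofReal_mul (by positivity), ← ENNReal.ofReal_coe_nnreal,
      ← ENNReal.ofReal_mul (by positivity), Nat.factorial_succ]
    congr 1
    push_cast
    field_simp
    ring
  rw [poissonMeasure, lintegral_sum_measure]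
  simp_rw [lintegral_smul_measure, lintegral_dirac, smul_eq_mul]
  rw [tsum_eq_zero_add' ENNReal.summable]
  simp_rw [hterm]
  rw [ENNReal.tsum_mul_left, ← ENNReal.ofReal_tsum_of_nonneg (fun n => by positivity)
    (hasSum_one_poissonMeasure r).summable, (hasSum_one_poissonMeasure r).tsum_eq]
  simp

theorem tsum_gammaPoissonMeasure_Ioi {α c ρ : ℝ} (hα : 0 < α) (hc : 0 < c) (hρ : 0 ≤ ρ) :
    ∑' k, gammaPoissonMeasure α c ρ (Ioi k) = ENNReal.ofReal (α / c * ρ) := by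
  rw [tsum_measure_Ioi, gammaPoissonMeasure, Measure.lintegral_bind
    (measurable_poissonMeasure_toNNReal ρ).aemeasurable (measurable_of_countable _).aemeasurable]
  simp_rw [lintegral_natCast_poissonMeasure]
  -- The mean of the gamma law is the case `k = 1`, `ρ = 0`.
  have h := lintegral_pow_mul_exp_gammaMeasure hα hc le_rfl 1
  simp only [pow_one, zero_mul, neg_zero, Real.exp_zero, mul_one, Nat.cast_one, add_zero] at h
  have h1 : ∀ b : ℝ, ((b * ρ).toNNReal : ℝ≥0∞) = ENNReal.ofReal b * ENNReal.ofReal ρ :=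
    fun b => ENNReal.ofReal_mul' hρ
  simp_rw [h1]
  rw [lintegral_mul_const _ (by fun_prop), h, ← ENNReal.ofReal_mul' hρ]
  congr 2
  have hG := (Real.Gamma_pos_of_pos hα).ne'
  rw [Real.Gamma_add_one hα.ne', Real.rpow_add_one hc.ne']
  have : c ^ α ≠ 0 := (Real.rpow_pos_of_pos hc α).ne'
  field_simp

/-- The power has shape `(n+1)α`; its coefficient `Γ((n+1)α + n) / (n! Γ((n+1)α))` is the
generalised binomial. -/
theorem coeff_offspringSeries_gammaPoissonMeasure_pow {α c ρ : ℝ} (hα : 0 < α)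
    (hc : 0 < c) (hρ : 0 ≤ ρ) (n : ℕ) :
    PowerSeries.coeff n (offspringSeries (gammaPoissonMeasure α c ρ) ^ (n + 1)) =
      genBinom ((α + 1) * ((n + 1 : ℕ) : ℝ) - 2) (((n + 1 : ℕ) : ℝ) - 1) *
        (c / (c + ρ)) ^ (α * ((n + 1 : ℕ) : ℝ)) * (ρ / (c + ρ)) ^ n := by
  rw [offspringSeries_gammaPoissonMeasure hα hc hρ, mul_pow, ← map_pow, negBinomialSeries_pow,
    PowerSeries.coeff_C_mul, coeff_negBinomialSeries _ (by positivity),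
    Real.rpow_mul (by positivity), Real.rpow_natCast, genBinom]
  have h1 : (α + 1) * ((n + 1 : ℕ) : ℝ) - 2 + 1 = ((n + 1 : ℕ) : ℝ) * α + n := by
    push_cast; ring
  have h2 : ((n + 1 : ℕ) : ℝ) - 1 + 1 = n + 1 := by push_cast; ring
  have h3 : (α + 1) * ((n + 1 : ℕ) : ℝ) - 2 - (((n + 1 : ℕ) : ℝ) - 1) + 1 =
      ((n + 1 : ℕ) : ℝ) * α := by push_cast; ring
  rw [h1, h2, h3, Real.Gamma_nat_eq_factorial]
  ring

end MixedPoisson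

/-! ### Total mass of the excitation. -/

section Excitation

variable {h : ℝ → ℝ}

theorem lintegral_Ici_const_mul_eq_l1Norm (h_nonneg : ∀ t, 0 ≤ t → 0 ≤ h t)
    (h_int : IntegrableOn h (Ici 0)) {b : ℝ} (hb : 0 ≤ b) :
    ∫⁻ t in Ici 0, ENNReal.ofReal (b * h t) = ENNReal.ofReal (b * l1Norm h) := by
  have h1 : l1Norm h = ∫ t in Ici 0, h t :=
    setIntegral_congr_fun measurableSet_Ici fun t ht => abs_of_nonneg (h_nonneg t ht)
  rw [h1, ← integral_const_mul, ofReal_integral_eq_lintegral_ofReal (h_int.const_mul b)]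
  exact (ae_restrict_iff' measurableSet_Ici).2
    (.of_forall fun t ht => mul_nonneg hb (h_nonneg t ht))

theorem intensityMeasure_univ (f : ℝ → ℝ) :
    intensityMeasure f univ = ∫⁻ t in Ici 0, ENNReal.ofReal (f t) := by
  rw [intensityMeasure, withDensity_apply _ MeasurableSet.univ, Measure.restrict_univ]

theorem intensityMeasure_hawkesExcitation_univ (h_nonneg : ∀ t, 0 ≤ t → 0 ≤ h t)
    (h_int : IntegrableOn h (Ici 0)) {b : ℝ} (hb : 0 ≤ b) (w : ℝ) :
    intensityMeasure (hawkesExcitation h b w) univ = ENNReal.ofReal (b * l1Norm h) := by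
  rw [intensityMeasure_univ]
  exact lintegral_Ici_const_mul_eq_l1Norm h_nonneg h_int hb

/-- Translation by `w` preserves Lebesgue measure, and `0 ≤ w` keeps the shifted support `(w, ∞)`
inside the half-line. Passing to open half-lines matches the strict inequality in the excitation. -/
theorem intensityMeasure_delayedHawkesExcitation_univ (h_nonneg : ∀ t, 0 ≤ t → 0 ≤ h t)
    (h_int : IntegrableOn h (Ici 0)) {b w : ℝ} (hb : 0 ≤ b) (hw : 0 ≤ w) :
    intensityMeasure (delayedHawkesExcitation h b w) univ = ENNReal.ofReal (b * l1Norm h) := by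
  rw [intensityMeasure_univ, ← lintegral_Ici_const_mul_eq_l1Norm h_nonneg h_int hb,
    setLIntegral_congr Ioi_ae_eq_Ici.symm, setLIntegral_congr Ioi_ae_eq_Ici.symm,
    ← lintegral_indicator measurableSet_Ioi, ← lintegral_indicator measurableSet_Ioi,
    
    ← lintegral_sub_right_eq_self ((Ioi 0).indicator fun t => ENNReal.ofReal (b * h t)) w]
  refine lintegral_congr fun t => ?_
  simp only [indicator, mem_Ioi, delayedHawkesExcitation, sub_pos]
  by_cases hwt : w < t
  · simp [hwt, hw.trans_lt hwt]
  · simp [hwt]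

end Excitation

/-! ### From clusters to Galton-Watson trees. -/

namespace ClusterData

variable {Ω : Type*} (X : ClusterData Ω)

/-- The number of children of an event, as a natural number. -/
noncomputable def childCount (r : ℕ) (u : List ℕ) (ω : Ω) : ℕ :=
  ⌊(X.offspring r u ω univ).toReal⌋₊

variable {X} in
-- The cluster has one unit atom per occurring label, so its mass counts labels. The hypothesis
-- excludes configurations where the floor or `toReal` in `childCount` loses information.
theorem clusterSize_eq_treeSize {r : ℕ} {ω : Ω}
    (hω : ∀ u, X.offspring r u ω univ = X.childCount r u ω) :
    X.clusterSize r ω = treeSize fun u => X.childCount r u ω := by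
  have hocc : ∀ u, X.Occurs r ω u ↔ IsNode (fun u => X.childCount r u ω) u := by
    intro u
    induction u with
    | nil => simp [Occurs, IsNode]
    | cons k u ih => simp [Occurs, IsNode, ih, hω u]
  rw [clusterSize, cluster, Measure.sum_apply _ MeasurableSet.univ]
  simp only [measure_univ]
  rw [treeSize, show {u | IsNode (fun u => X.childCount r u ω) u} = {u | X.Occurs r ω u} from
      Set.ext fun u => (hocc u).symm, ← ENNReal.tsum_set_one]
  rfl

variable [MeasurableSpace Ω] {X} {P : Measure Ω} {lam0 : ℝ} {markLaw serviceLaw : Measure ℝ}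
  {φ : ℝ → ℝ → ℝ → ℝ}

theorem IsHawkes.measurable_childCount (hX : X.IsHawkes P lam0 markLaw serviceLaw φ) (r : ℕ)
    (u : List ℕ) : Measurable (X.childCount r u) :=
  Nat.measurable_floor.comp (((Measure.measurable_coe MeasurableSet.univ).comp
    (hX.measurable_offspring r u)).ennreal_toReal)

theorem IsHawkes.iIndepFun_childCount (hX : X.IsHawkes P lam0 markLaw serviceLaw φ) (r : ℕ) :
    iIndepFun (X.childCount r) P :=
  (hX.indep_events.precomp (g := fun u : List ℕ => (r, u)) (Prod.mk_right_injective r)).comp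
    (fun _ q => ⌊(q.2 univ).toReal⌋₊) fun _ =>
      Nat.measurable_floor.comp
        (((Measure.measurable_coe MeasurableSet.univ).comp measurable_snd).ennreal_toReal)

/-- If the total excitation of an event with mark `b` is `b * ρ`, then its number of children is
mixed Poisson. -/
theorem IsHawkes.map_offspring_univ {α c ρ : ℝ} [SFinite (gammaMeasure α c)]
    [IsProbabilityMeasure serviceLaw]
    (hX : X.IsHawkes P lam0 (gammaMeasure α c) serviceLaw φ)
    (hφ : ∀ᵐ p ∂(gammaMeasure α c).prod serviceLaw,
      intensityMeasure (φ p.1 p.2) univ = ENNReal.ofReal (p.1 * ρ)) (r : ℕ) (u : List ℕ) :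
    P.map (fun ω => X.offspring r u ω univ) =
      (gammaPoissonMeasure α c ρ).map (fun n : ℕ => (n : ℝ≥0∞)) := by
  obtain ⟨κ, hκ, hκlaw, hmap⟩ := hX.event_law
  have hm : Measurable fun N : Measure ℝ => N univ := Measure.measurable_coe MeasurableSet.univ
  have hcast : Measurable fun n : ℕ => (n : ℝ≥0∞) := measurable_of_countable _
  have hoff := hX.measurable_offspring r u
  have hev : Measurable fun ω => ((X.mark r u ω, X.service r u ω), X.offspring r u ω) :=
    ((hX.measurable_mark r u).prodMk (hX.measurable_service r u)).prodMk hoff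
  ext s hs
  have hs' : MeasurableSet {q : (ℝ × ℝ) × Measure ℝ | q.2 univ ∈ s} := hm.comp measurable_snd hs
  have h1 : P.map (fun ω => X.offspring r u ω univ) s =
      P.map (fun ω => ((X.mark r u ω, X.service r u ω), X.offspring r u ω))
        {q | q.2 univ ∈ s} := by
    rw [Measure.map_apply (f := fun ω => X.offspring r u ω univ) (hm.comp hoff) hs,
      Measure.map_apply hev hs']
    rfl
  have h2 : ∀ᵐ p ∂(gammaMeasure α c).prod serviceLaw, κ p (Prod.mk p ⁻¹' {q | q.2 univ ∈ s}) =
      poissonMeasure (p.1 * ρ).toNNReal ((fun n : ℕ => (n : ℝ≥0∞)) ⁻¹' s) := by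
    filter_upwards [hφ, hκlaw] with p hp hlaw
    have h3 := hlaw.count_law univ MeasurableSet.univ (by rw [hp]; exact ENNReal.ofReal_ne_top)
    rw [hp] at h3
    have h4 := congrArg (fun μ : Measure ℝ≥0∞ => μ s) h3
    simp only [Measure.map_apply hm hs, Measure.map_apply hcast hs] at h4
    exact h4
  rw [h1, hmap, Measure.compProd_apply hs', lintegral_congr_ae h2,
    Measure.map_apply hcast hs, gammaPoissonMeasure_apply]
  have h5 : Measurable fun b : ℝ =>
      poissonMeasure (b * ρ).toNNReal ((fun n : ℕ => (n : ℝ≥0∞)) ⁻¹' s) :=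
    (Measure.measurable_coe (hcast hs)).comp (measurable_poissonMeasure_toNNReal ρ)
  -- The integrand depends on the mark alone, so the service requirement integrates out.
  have h6 := lintegral_map h5 (measurable_fst (α := ℝ) (β := ℝ))
    (μ := (gammaMeasure α c).prod serviceLaw)
  rw [← h6, Measure.map_fst_prod, measure_univ, one_smul]

theorem map_childCount_eq {μ : Measure ℕ} {r : ℕ} {u : List ℕ}
    (hoff : Measurable (X.offspring r u))
    (hlaw : P.map (fun ω => X.offspring r u ω univ) = μ.map (fun n : ℕ => (n : ℝ≥0∞))) :
    P.map (X.childCount r u) = μ := by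
  have hm : Measurable fun ω => X.offspring r u ω univ :=
    (Measure.measurable_coe MeasurableSet.univ).comp hoff
  have hf : Measurable fun x : ℝ≥0∞ => ⌊x.toReal⌋₊ :=
    Nat.measurable_floor.comp ENNReal.measurable_toReal
  have h1 : P.map (X.childCount r u) =
      (P.map (fun ω => X.offspring r u ω univ)).map fun x => ⌊x.toReal⌋₊ :=
    (Measure.map_map hf hm).symm
  rw [h1, hlaw, Measure.map_map hf (measurable_of_countable _)]
  have : (fun x : ℝ≥0∞ => ⌊x.toReal⌋₊) ∘ (fun n : ℕ => (n : ℝ≥0∞)) = id := by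
    ext n
    simp
  rw [this, Measure.map_id]

/-- The law of the total mass is carried by the natural numbers, where the floor changes nothing. -/
theorem ae_offspring_univ_eq_childCount {μ : Measure ℕ} {r : ℕ} {u : List ℕ}
    (hoff : Measurable (X.offspring r u))
    (hlaw : P.map (fun ω => X.offspring r u ω univ) = μ.map (fun n : ℕ => (n : ℝ≥0∞))) :
    ∀ᵐ ω ∂P, X.offspring r u ω univ = X.childCount r u ω := by
  have hm : Measurable fun ω => X.offspring r u ω univ :=
    (Measure.measurable_coe MeasurableSet.univ).comp hoff
  have hf : Measurable fun x : ℝ≥0∞ => ⌊x.toReal⌋₊ :=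
    Nat.measurable_floor.comp ENNReal.measurable_toReal
  have hset : MeasurableSet {x : ℝ≥0∞ | x = (⌊x.toReal⌋₊ : ℕ)} :=
    measurableSet_eq_fun measurable_id ((measurable_of_countable _).comp hf)
  have : ∀ᵐ x ∂P.map (fun ω => X.offspring r u ω univ), x ∈ {x : ℝ≥0∞ | x = (⌊x.toReal⌋₊ : ℕ)} := by
    rw [hlaw]
    exact (ae_map_iff (measurable_of_countable _).aemeasurable hset).2 (by simp)
  exact (ae_map_iff hm.aemeasurable hset).1 this

end ClusterData

/-! ### The law of the cluster size. -/

theorem proposition1 {Ω : Type*} [MeasurableSpace Ω] (P : Measure Ω) [IsProbabilityMeasure P]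
    (lam0 : ℝ) (hlam0 : 0 < lam0)
    (α c : ℝ) (hα : 0 < α) (hc : 0 < c)
    (h : ℝ → ℝ) (h_nonneg : ∀ t, 0 ≤ t → 0 ≤ h t) (h_int : IntegrableOn h (Ici 0))
    (h_stable : α / c * l1Norm h < 1)
    (serviceLaw : Measure ℝ) [IsProbabilityMeasure serviceLaw]
    (h_service : ∀ᵐ w ∂serviceLaw, 0 ≤ w)
    (φ : ℝ → ℝ → ℝ → ℝ) (hφ : φ = hawkesExcitation h ∨ φ = delayedHawkesExcitation h)
    (X : ClusterData Ω) (hX : X.IsHawkes P lam0 (gammaMeasure α c) serviceLaw φ) (r : ℕ) :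
    (∀ᵐ ω ∂P, X.clusterSize r ω < ∞) ∧
      ∀ n : ℕ, 1 ≤ n →
        P {ω | X.clusterSize r ω = (n : ℝ≥0∞)} =
          ENNReal.ofReal (1 / (n : ℝ) * genBinom ((α + 1) * n - 2) ((n : ℝ) - 1) *
            (c / (c + l1Norm h)) ^ (α * n) *
            (l1Norm h / (c + l1Norm h)) ^ (n - 1)) := by
  have hγ := isProbabilityMeasure_gammaMeasure hα hc
  have hρ : 0 ≤ l1Norm h := integral_nonneg fun t => abs_nonneg (h t)
  have hν := isProbabilityMeasure_gammaPoissonMeasure hα hc (l1Norm h)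
  set ν := gammaPoissonMeasure α c (l1Norm h) with hν_def
  have hφ' : ∀ᵐ p ∂(gammaMeasure α c).prod serviceLaw,
      intensityMeasure (φ p.1 p.2) univ = ENNReal.ofReal (p.1 * l1Norm h) := by
    have hb : ∀ᵐ p ∂(gammaMeasure α c).prod serviceLaw, 0 < p.1 :=
      Measure.quasiMeasurePreserving_fst.ae gammaMeasure_ae_pos
    have hw : ∀ᵐ p ∂(gammaMeasure α c).prod serviceLaw, 0 ≤ p.2 :=
      Measure.quasiMeasurePreserving_snd.ae h_service
    filter_upwards [hb, hw] with p hb hw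
    rcases hφ with rfl | rfl
    · exact intensityMeasure_hawkesExcitation_univ h_nonneg h_int hb.le p.2
    · exact intensityMeasure_delayedHawkesExcitation_univ h_nonneg h_int hb.le hw
  have hlaw := hX.map_offspring_univ hφ' r
  have hmeas : Measurable fun ω u => X.childCount r u ω :=
    measurable_pi_iff.2 fun u => hX.measurable_childCount r u
  have hmap : P.map (fun ω u => X.childCount r u ω) = offspringLaw ν := by
    rw [(hX.iIndepFun_childCount r).map_fun_eq_infinitePi_map fun u =>
      hX.measurable_childCount r u, offspringLaw]
    congr 1
    ext1 u
    exact ClusterData.map_childCount_eq (hX.measurable_offspring r u) (hlaw u)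
  have hae : ∀ᵐ ω ∂P, X.clusterSize r ω = treeSize fun u => X.childCount r u ω := by
    -- There are countably many labels, so one null set serves them all.
    have : ∀ᵐ ω ∂P, ∀ u, X.offspring r u ω univ = X.childCount r u ω :=
      ae_all_iff.2 fun u =>
        ClusterData.ae_offspring_univ_eq_childCount (hX.measurable_offspring r u) (hlaw u)
    filter_upwards [this] with ω hω using ClusterData.clusterSize_eq_treeSize hω
  constructor
  · have hfin : ∑' k, ν (Ioi k) < 1 := by
      rw [hν_def, tsum_gammaPoissonMeasure_Ioi hα hc hρ]
      exact ENNReal.ofReal_lt_one.2 h_stable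
    have := ae_treeSize_lt_top ν hfin
    rw [← hmap] at this
    filter_upwards [hae, ae_of_ae_map hmeas.aemeasurable this] with ω h1 h2
    rw [h1]
    exact ENat.toENNReal_lt_top.2 h2
  · intro n hn
    obtain ⟨m, rfl⟩ := Nat.exists_eq_add_of_le' hn
    have h1 : P {ω | X.clusterSize r ω = ((m + 1 : ℕ) : ℝ≥0∞)} =
        offspringLaw ν {η | treeSize η = ((m + 1 : ℕ) : ℕ∞)} := by
      rw [← hmap, Measure.map_apply hmeas (measurableSet_treeSize_eq _)]
      refine measure_congr ?_
      filter_upwards [hae] with ω hω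
      refine propext ?_
      change X.clusterSize r ω = _ ↔ (treeSize fun u => X.childCount r u ω) = _
      rw [hω, ← ENat.toENNReal_coe, ENat.toENNReal_inj]
    rw [h1, ← ofReal_measureReal, offspringLaw_real_treeSize_eq,
      coeff_offspringSeries_gammaPoissonMeasure_pow hα hc hρ, Nat.add_sub_cancel]
    congr 1
    ring
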